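/- Let $R$ be a commutative Noetherian ring of finite Krull dimension and let $M$ be a finitely generated $R$-module. The \emph{length} $\operatorname{len}(M)$ of $M$ is the ordinal that is the supremum of the order types of all strictly descending chains of non-zero submodules of $M$. Call $M$ \emph{bivalent} if the coefficients in the Cantor normal form (base $\omega$) of $\operatorname{len}(M)$ add up to $2$, and say that $M$ has \emph{binary length} if all these coefficients are $0$ or $1$. For a prime ideal $\mathfrak p$ write $\dim(\mathfrak p)$ for the Krull dimension of $R/\mathfrak p$. Then $M$ is bivalent if and only if there exist prime ideals $\mathfrak p,\mathfrak q$ of $R$ with $\dim(\mathfrak q)\le\dim(\mathfrak p)$, ideals $I\supsetneq\mathfrak p$ and $J\supsetneq\mathfrak q$, and an exact sequence of $R$-modules $$0\to J(R/\mathfrak q)\to M\to I(R/\mathfrak p)\to 0.$$ Moreover, if $M$ has binary length, then $\dim(\mathfrak q)<\dim(\mathfrak p)$ for every such sequence. -/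

import Mathlib

universe u v

namespace TransfiniteLength

/-- The ordinals `α` for which there is a strictly descending chain of non-zero submodules of `M`
that is indexed by the ordinals below `α`. (The zero submodule is left out so that the chain
`M ⊋ 0` of a simple module has length one: as usual, one counts the steps of a chain ending in
`0`.) -/
def chainTypes (R : Type u) (M : Type v) [CommRing R] [AddCommGroup M] [Module R M] :
    Set Ordinal.{v} :=
  {α | ∃ N : Ordinal.{v} → Submodule R M,
    StrictAntiOn N (Set.Iio α) ∧ ∀ i < α, N i ≠ ⊥}

/-- The supremum in the definition of length is a genuine one. -/
theorem bddAbove_chainTypes (R : Type u) (M : Type v) [CommRing R] [AddCommGroup M]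
    [Module R M] : BddAbove (chainTypes R M) := by
  refine ⟨(Order.succ (Cardinal.mk (Submodule R M))).ord, ?_⟩
  rintro α ⟨N, hN, -⟩
  refine le_of_lt (Cardinal.lt_ord.2 (Order.lt_succ_of_le ?_))
  rw [← Cardinal.lift_le.{v + 1}, ← Cardinal.mk_Iio_ordinal]
  have h : Function.Injective (fun i : Set.Iio α => N i) := fun i j hij =>
    Subtype.ext (hN.injOn i.2 j.2 hij)
  simpa using Cardinal.mk_le_of_injective
    (f := fun i : Set.Iio α => (ULift.up (N i) : ULift.{v + 1} (Submodule R M)))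
    (fun i j hij => h (ULift.up_injective hij))

/-- The ordinal length of a Noetherian module: the supremum of the order types of its descending
chains of submodules. -/
noncomputable def len (R : Type u) (M : Type v) [CommRing R] [AddCommGroup M] [Module R M] :
    Ordinal.{v} :=
  sSup (chainTypes R M)

/-- The valence of an ordinal: the sum of the coefficients in its Cantor normal form
(base `ω`). -/
noncomputable def valence (α : Ordinal.{v}) : Ordinal.{v} :=
  ((Ordinal.CNF Ordinal.omega0 α).map Prod.snd).sum

/-- An ordinal is binary if all coefficients in its Cantor normal form are `0` or `1`. -/
def IsBinaryOrdinal (α : Ordinal.{v}) : Prop :=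
  ∀ e : Ordinal.{v}, Ordinal.CNF.coeff Ordinal.omega0 α e = 0 ∨
    Ordinal.CNF.coeff Ordinal.omega0 α e = 1

/-- A module is bivalent if its length has valence two. -/
def IsBivalent (R : Type u) (M : Type v) [CommRing R] [AddCommGroup M] [Module R M] : Prop :=
  valence (len R M) = 2

/-- A module has binary length if its length is a binary ordinal. -/
def HasBinaryLength (R : Type u) (M : Type v) [CommRing R] [AddCommGroup M] [Module R M] :
    Prop :=
  IsBinaryOrdinal (len R M)

/-- The extension `I (R ⧸ p)` of an ideal `I` to the residue ring `R ⧸ p`. -/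
abbrev extendedIdeal {R : Type u} [CommRing R] (I p : Ideal R) : Ideal (R ⧸ p) :=
  I.map (Ideal.Quotient.mk p)

/-- There is an exact sequence of `R`-modules `0 → J (R ⧸ q) → M → I (R ⧸ p) → 0`. -/
def IsExtensionOfIdeals {R : Type u} (M : Type v) [CommRing R] [AddCommGroup M] [Module R M]
    (p q I J : Ideal R) : Prop :=
  ∃ (f : extendedIdeal J q →ₗ[R] M) (g : M →ₗ[R] extendedIdeal I p),
    Function.Injective f ∧ Function.Exact f g ∧ Function.Surjective g

end TransfiniteLength

/-! Length is studied through `moduleRank`, the well-founded rank of the zero submodule under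
reverse inclusion. In an exact sequence 0 → N → M → L → 0 the rank of M lies between the ordinary
sum rank L + rank N and the natural (Hessenberg) sum of the two. When rank L = ω^a and rank N <
ω^(a+1) both bounds agree, so rank M = ω^a + rank N; conversely a module of rank ω^a + x with x <
ω^(a+1) splits into a quotient of rank ω^a and a submodule of rank x
(`exists_submodule_moduleRank_eq`).

The finitely generated modules whose rank is a power of ω are exactly the nonzero modules embedding
in some R/p, that is, the nonzero ideals I(R/p), and the exponent is then dim R/p
(`exists_injective_to_quotient_prime`, `moduleRank_eq_omega0_opow`). Valence two means that the
length is ω^a + ω^b with b ≤ a, so the equivalence follows once length is known to equal rank. Since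
length asks for actual chains, this needs a chain of type ω^d in R/p (`exists_strictAntiOn_ideal`)
and concatenation of chains along extensions (`len_eq_moduleRank`). -/

namespace TransfiniteLength

open Ordinal Order

/-! ### Natural sums of ordinals near powers of ω. -/

section NaturalSum

/-- The natural (Hessenberg) sum of two ordinals: the least operation that is strictly monotone
in both arguments. -/
noncomputable def naturalSum (a b : Ordinal.{u}) : Ordinal.{u} :=
  max (⨆ x : Set.Iio a, succ (naturalSum x.1 b)) (⨆ x : Set.Iio b, succ (naturalSum a x.1))
termination_by (a, b)
decreasing_by
  · exact Prod.Lex.left _ _ x.2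
  · exact Prod.Lex.right _ x.2

theorem naturalSum_le_iff {a b c : Ordinal.{u}} :
    naturalSum a b ≤ c ↔ (∀ x < a, naturalSum x b < c) ∧ ∀ x < b, naturalSum a x < c := by
  rw [naturalSum, max_le_iff, Ordinal.iSup_le_iff, Ordinal.iSup_le_iff]
  simp

theorem naturalSum_lt_left {a a' : Ordinal.{u}} (b : Ordinal.{u}) (h : a' < a) :
    naturalSum a' b < naturalSum a b :=
  (naturalSum_le_iff.1 le_rfl).1 a' h

theorem naturalSum_lt_right {b b' : Ordinal.{u}} (a : Ordinal.{u}) (h : b' < b) :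
    naturalSum a b' < naturalSum a b :=
  (naturalSum_le_iff.1 le_rfl).2 b' h

theorem naturalSum_le_naturalSum {a a' b b' : Ordinal.{u}} (ha : a ≤ a') (hb : b ≤ b') :
    naturalSum a b ≤ naturalSum a' b' := by
  have h₁ : StrictMono (naturalSum · b) := fun _ _ h => naturalSum_lt_left b h
  have h₂ : StrictMono (naturalSum a') := fun _ _ h => naturalSum_lt_right a' h
  exact (h₁.monotone ha).trans (h₂.monotone hb)

theorem zero_naturalSum (b : Ordinal.{u}) : naturalSum 0 b = b := by
  induction b using WellFoundedLT.induction with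
  | ind b ih =>
    refine le_antisymm (naturalSum_le_iff.2 ⟨fun x hx => absurd hx not_lt_zero, fun x hx => ?_⟩) ?_
    · rwa [ih x hx]
    · refine le_of_forall_lt fun x hx => ?_
      rw [← ih x hx]
      exact naturalSum_lt_right 0 hx

/-- An ordinal below ω^d·k + c has either a smaller coefficient or the same coefficient and a
smaller remainder. In the first case a whole ω^d is lost, which outweighs any remainder by `hd`; in
the second the remainders decrease. Hence the nested induction on coefficients and remainders. -/
theorem naturalSum_omega0_opow_mul_add_le {d : Ordinal.{u}}
    (hd : ∀ a < ω ^ d, ∀ b < ω ^ d, naturalSum a b < ω ^ d) (n m : ℕ) {a b : Ordinal.{u}}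
    (ha : a < ω ^ d) (hb : b < ω ^ d) :
    naturalSum (ω ^ d * n + a) (ω ^ d * m + b) ≤ ω ^ d * (n + m : ℕ) + naturalSum a b := by
  have key : ∀ k l : ℕ, k < l → ∀ c < ω ^ d, ∀ e, ω ^ d * (k : Ordinal.{u}) + c < ω ^ d * l + e := by
    intro k l hkl c hc e
    calc ω ^ d * (k : Ordinal.{u}) + c < ω ^ d * k + ω ^ d := by gcongr
      _ = ω ^ d * (k + 1 : ℕ) := by rw [Nat.cast_succ, mul_add_one]
      _ ≤ ω ^ d * l := by gcongr; exact_mod_cast hkl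
      _ ≤ _ := le_self_add
  have split : ∀ (k : ℕ) (c x : Ordinal.{u}), c < ω ^ d → x < ω ^ d * k + c →
      ∃ (l : ℕ) (e : Ordinal.{u}), e < ω ^ d ∧ x = ω ^ d * l + e ∧ (l < k ∨ l = k ∧ e < c) := by
    intro k c x hc hx
    have h0 : ω ^ d ≠ 0 := (opow_pos d omega0_pos).ne'
    have hx' : x < ω ^ d * (k + 1 : ℕ) := by
      rw [Nat.cast_succ, mul_add_one]
      exact hx.trans (by gcongr)
    have hq : x / ω ^ d < (k + 1 : ℕ) := (lt_mul_iff_div_lt h0).1 hx'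
    obtain ⟨l, hl⟩ := lt_omega0.1 (hq.trans (natCast_lt_omega0 _))
    refine ⟨l, x % ω ^ d, mod_lt _ h0, by rw [← hl, div_add_mod], ?_⟩
    rw [hl] at hq
    rcases (Nat.lt_succ_iff.1 (by exact_mod_cast hq : l < k + 1)).lt_or_eq with h | h
    · exact .inl h
    · refine .inr ⟨h, ?_⟩
      rw [← div_add_mod x (ω ^ d), hl, h] at hx
      simpa using hx
  induction n using Nat.strong_induction_on generalizing m a b with
  | _ n ihn =>
  induction a using WellFoundedLT.induction generalizing m b with
  | ind a iha =>
  induction m using Nat.strong_induction_on generalizing b with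
  | _ m ihm =>
  induction b using WellFoundedLT.induction with
  | ind b ihb =>
  refine naturalSum_le_iff.2 ⟨fun x hx => ?_, fun x hx => ?_⟩
  · obtain ⟨l, e, he, rfl, h | ⟨rfl, h⟩⟩ := split n a x ha hx
    · exact (ihn l h m he hb).trans_lt (key _ _ (by lia) _ (hd e he b hb) _)
    · refine (iha e h m he hb).trans_lt ?_
      gcongr
      exact naturalSum_lt_left b h
  · obtain ⟨l, e, he, rfl, h | ⟨rfl, h⟩⟩ := split m b x hb hx
    · exact (ihm l h he).trans_lt (key _ _ (by lia) _ (hd a ha e he) _)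
    · refine (ihb e h he).trans_lt ?_
      gcongr
      exact naturalSum_lt_right a h

theorem naturalSum_lt_omega0_opow (d : Ordinal.{u}) :
    ∀ a < ω ^ d, ∀ b < ω ^ d, naturalSum a b < ω ^ d := by
  induction d using WellFoundedLT.induction with
  | ind d ih =>
  intro a ha b hb
  rcases eq_or_ne d 0 with rfl | hd
  · rw [opow_zero, Order.lt_one_iff] at *
    rw [ha, hb, zero_naturalSum]
  obtain ⟨c, hc, n, hn⟩ := (lt_omega0_opow hd).1 ha
  obtain ⟨e, he, m, hm⟩ := (lt_omega0_opow hd).1 hb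
  have h0 : 0 < ω ^ max c e := opow_pos _ omega0_pos
  have hlt : max c e < d := max_lt hc he
  have hn' : a ≤ ω ^ max c e * n + 0 := by
    rw [add_zero]
    exact hn.le.trans (mul_le_mul_left (opow_le_opow_right omega0_pos (le_max_left _ _)) _)
  have hm' : b ≤ ω ^ max c e * m + 0 := by
    rw [add_zero]
    exact hm.le.trans (mul_le_mul_left (opow_le_opow_right omega0_pos (le_max_right _ _)) _)
  refine (naturalSum_le_naturalSum hn' hm').trans_lt <|
    (naturalSum_omega0_opow_mul_add_le (ih _ hlt) n m h0 h0).trans_lt ?_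
  rw [zero_naturalSum, add_zero]
  -- The extra 1 turns the bound by ω^(max c e)·(n + m) into a strict one.
  exact (lt_omega0_opow hd).2 ⟨max c e, hlt, n + m + 1,
    mul_lt_mul_of_pos_left (by exact_mod_cast Nat.lt_succ_self _) h0⟩

/-- No exponent in x exceeds d, so ω^d already stands in front and the natural sum reorders nothing:
this is the case of coefficient 1 and remainder 0 on the left. -/
theorem omega0_opow_naturalSum_le {d x : Ordinal.{u}} (hx : x < ω ^ succ d) :
    naturalSum (ω ^ d) x ≤ ω ^ d + x := by
  have h0 : 0 < ω ^ d := opow_pos _ omega0_pos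
  obtain ⟨n, hn⟩ := lt_omega0_opow_succ.1 hx
  have hq : x / ω ^ d < n := (lt_mul_iff_div_lt h0.ne').1 hn
  obtain ⟨l, hl⟩ := lt_omega0.1 (hq.trans (natCast_lt_omega0 _))
  have h := naturalSum_omega0_opow_mul_add_le (naturalSum_lt_omega0_opow d) 1 l h0
    (mod_lt x h0.ne')
  rw [zero_naturalSum, ← hl, div_add_mod, Nat.cast_add, ← hl, mul_add, add_assoc,
    div_add_mod] at h
  simpa using h

end NaturalSum

/-! ### Cantor normal forms of valence two. -/

section Valence

theorem valence_omega0_opow_add {a b : Ordinal.{u}} (h : b ≤ a) :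
    valence (ω ^ a + ω ^ b) = 2 := by
  have h1 : (1 : Ordinal.{u}) < ω := one_lt_omega0
  rcases h.lt_or_eq with h | rfl
  · have e : ω ^ a + ω ^ b = ω ^ a * 1 + (ω ^ b * 1 + 0) := by simp
    rw [valence, e, CNF.opow_mul_add h1 one_ne_zero h1, CNF.opow_mul_add h1 one_ne_zero h1]
    · simp [one_add_one_eq_two]
    · exact opow_pos _ omega0_pos
    · simpa using (opow_lt_opow_iff_right h1).2 h
  · have e : ω ^ b + ω ^ b = ω ^ b * 2 + 0 := by simp [← one_add_one_eq_two, mul_add]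
    rw [valence, e, CNF.opow_mul_add h1 two_ne_zero (by exact_mod_cast natCast_lt_omega0 2)]
    · simp
    · exact opow_pos _ omega0_pos

theorem not_isBinaryOrdinal_omega0_opow_add_self (b : Ordinal.{u}) :
    ¬ IsBinaryOrdinal (ω ^ b + ω ^ b) := by
  intro h
  have e : ω ^ b + ω ^ b = ω ^ b * 2 + 0 := by simp [← one_add_one_eq_two, mul_add]
  have h2 := CNF.coeff_opow_mul_add (b := ω) (e := b) (x := 2) (y := 0)
    one_lt_omega0 two_ne_zero (show (2 : Ordinal.{u}) < ω by exact_mod_cast natCast_lt_omega0 2)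
    (opow_pos _ omega0_pos)
  have := h b
  rw [e, h2] at this
  simp at this

/-- Listed coefficients are at least 1, so total 2 leaves one entry with coefficient 2 or two
entries with coefficient 1. -/
theorem exists_eq_omega0_opow_add_of_valence_eq_two {o : Ordinal.{u}} (h : valence o = 2) :
    ∃ a b : Ordinal.{u}, b ≤ a ∧ o = ω ^ a + ω ^ b := by
  have hf := CNF.foldr ω o
  have hp : ∀ x ∈ CNF ω o, 1 ≤ x.2 := fun x hx => one_le_iff_pos.2 (CNF.snd_pos hx)
  have hs := CNF.sortedGT ω o
  rw [valence] at h
  rcases hl : CNF ω o with _ | ⟨⟨a, c⟩, _ | ⟨⟨b, e⟩, t⟩⟩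
  · simp [hl] at h
  · rw [hl] at h hf
    simp at h hf
    exact ⟨a, a, le_rfl, by rw [← hf, h, ← one_add_one_eq_two, mul_add, mul_one]⟩
  · rw [hl] at h hf hs hp
    simp only [List.map_cons, List.sum_cons] at h
    have hc : 1 ≤ c := hp (a, c) (by simp)
    have he : 1 ≤ e := hp (b, e) (by simp)
    have hba : b < a := by
      have := hs.pairwise
      simp at this
      exact this.1.1
    have hs2 : e + (t.map Prod.snd).sum ≤ 1 := by
      have : 1 + (e + (t.map Prod.snd).sum) ≤ 1 + 1 := by
        rw [one_add_one_eq_two, ← h]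
        gcongr
      exact le_of_add_le_add_left this
    have he1 : e = 1 := le_antisymm (le_self_add.trans hs2) he
    subst he1
    have hs0 : (t.map Prod.snd).sum = 0 := by
      refine le_antisymm (le_of_add_le_add_left (a := 1) ?_) zero_le
      simpa using hs2
    have ht : t = [] := by
      rcases t with _ | ⟨x, t⟩
      · rfl
      · have hx : 1 ≤ x.2 := hp x (by simp)
        simp only [List.map_cons, List.sum_cons] at hs0
        exact absurd (hx.trans (le_self_add.trans hs0.le)) (by simp)
    subst ht
    have hc1 : c = 1 := by
      simp only [List.map_nil, List.sum_nil, add_zero, ← one_add_one_eq_two] at h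
      exact Order.add_one_inj.1 h
    subst hc1
    refine ⟨a, b, hba.le, ?_⟩
    simpa using hf.symm

end Valence

/-! ### Ordinal rank of modules and its behaviour in exact sequences. -/

section Rank

variable {R : Type u} [CommRing R] {L M N : Type v} [AddCommGroup L] [Module R L]
  [AddCommGroup M] [Module R M] [AddCommGroup N] [Module R N]

/-- Preimages of the chain in L come first, followed by images of the chain in N. The junction is
strict because the terms in L are nonzero, so their preimages properly contain the kernel of `g`. -/
theorem add_mem_chainTypes {f : N →ₗ[R] M} {g : M →ₗ[R] L} (hf : Function.Injective f)
    (hfg : Function.Exact f g) (hg : Function.Surjective g) {α β : Ordinal.{v}}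
    (hα : α ∈ chainTypes R L) (hβ : β ∈ chainTypes R N) : α + β ∈ chainTypes R M := by
  classical
  obtain ⟨A, hA, hA0⟩ := hα
  obtain ⟨B, hB, hB0⟩ := hβ
  have hsub : ∀ i, α ≤ i → i < α + β → i - α < β := fun i h₁ h₂ =>
    lt_of_add_lt_add_left (a := α) (by rwa [Ordinal.add_sub_cancel_of_le h₁])
  refine ⟨fun i => if i < α then (A i).comap g else (B (i - α)).map f, ?_, ?_⟩
  · intro i hi j hj hij
    rw [Set.mem_Iio] at hi hj
    by_cases hjα : j < α
    · simp only [hjα, hij.trans hjα, if_true]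
      exact Submodule.comap_strictMono_of_surjective hg (hA (hij.trans hjα) hjα hij)
    by_cases hiα : i < α
    · simp only [hjα, hiα, if_true, if_false]
      calc (B (j - α)).map f ≤ LinearMap.range f := LinearMap.map_le_range
        _ = (⊥ : Submodule R L).comap g := (LinearMap.exact_iff.1 hfg).symm
        _ < _ := Submodule.comap_strictMono_of_surjective hg (bot_lt_iff_ne_bot.2 (hA0 i hiα))
    · simp only [hjα, hiα, if_false]
      push Not at hjα hiα
      refine Submodule.map_strictMono_of_injective hf
        (hB (hsub i hiα hi) (hsub j hjα hj) (lt_of_add_lt_add_left (a := α) ?_))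
      rwa [Ordinal.add_sub_cancel_of_le hiα, Ordinal.add_sub_cancel_of_le hjα]
  · intro i hi
    by_cases hiα : i < α
    · simp only [hiα, if_true]
      have := Submodule.comap_strictMono_of_surjective hg (bot_lt_iff_ne_bot.2 (hA0 i hiα))
      exact (bot_le.trans_lt this).ne'
    · simp only [hiα, if_false]
      push Not at hiα
      have := Submodule.map_strictMono_of_injective hf
        (bot_lt_iff_ne_bot.2 (hB0 _ (hsub i hiα hi)))
      exact (bot_le.trans_lt this).ne'

variable [IsNoetherian R L] [IsNoetherian R M] [IsNoetherian R N]

/-- The rank of a submodule with respect to the well-founded relation of strict reverse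
inclusion. -/
noncomputable def submoduleRank (P : Submodule R M) : Ordinal.{v} :=
  IsWellFounded.rank (α := Submodule R M) (· > ·) P

variable (R M) in
/-- The rank of the zero submodule with respect to strict reverse inclusion. -/
noncomputable def moduleRank : Ordinal.{v} :=
  submoduleRank (⊥ : Submodule R M)

theorem submoduleRank_strictAnti :
    StrictAnti (submoduleRank : Submodule R M → Ordinal.{v}) :=
  WellFoundedGT.rank_strictAnti

theorem submoduleRank_le_iff {P : Submodule R M} {c : Ordinal.{v}} :
    submoduleRank P ≤ c ↔ ∀ P' > P, submoduleRank P' < c := by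
  refine ⟨fun h P' hP' => (submoduleRank_strictAnti hP').trans_le h, fun h => ?_⟩
  rw [submoduleRank, IsWellFounded.rank_eq, Ordinal.iSup_le_iff]
  exact fun P' => succ_le_of_lt (h P'.1 P'.2)

theorem lt_submoduleRank_iff {P : Submodule R M} {c : Ordinal.{v}} :
    c < submoduleRank P ↔ ∃ P' > P, c ≤ submoduleRank P' := by
  rw [← not_le, submoduleRank_le_iff]
  simp

theorem submoduleRank_comap {g : M →ₗ[R] L} (hg : Function.Surjective g) (P : Submodule R L) :
    submoduleRank (P.comap g) = submoduleRank P := by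
  induction P using WellFoundedGT.induction with
  | ind P ih =>
  refine le_antisymm (submoduleRank_le_iff.2 fun Q hQ => ?_) (submoduleRank_le_iff.2 fun Q hQ => ?_)
  · have hQ' : (Q.map g).comap g = Q := by
      rw [Submodule.comap_map_eq, sup_eq_left]
      exact (LinearMap.ker_le_comap g).trans hQ.le
    have hlt : P < Q.map g := by
      rw [← Submodule.comap_lt_comap_iff_of_surjective hg, hQ']
      exact hQ
    rw [← hQ', ih _ hlt]
    exact submoduleRank_strictAnti hlt
  · rw [← ih Q hQ]
    exact submoduleRank_strictAnti (Submodule.comap_strictMono_of_surjective hg hQ)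

theorem moduleRank_eq_of_surjective {g : M →ₗ[R] L} (hg : Function.Surjective g) :
    moduleRank R L = submoduleRank (LinearMap.ker g) :=
  (submoduleRank_comap hg ⊥).symm

theorem moduleRank_quotient (P : Submodule R M) :
    moduleRank R (M ⧸ P) = submoduleRank P := by
  rw [moduleRank_eq_of_surjective P.mkQ_surjective, Submodule.ker_mkQ]

theorem moduleRank_congr (e : M ≃ₗ[R] L) : moduleRank R M = moduleRank R L := by
  rw [moduleRank_eq_of_surjective (g := e.toLinearMap) e.surjective, LinearEquiv.ker, moduleRank]

theorem moduleRank_eq_zero [Subsingleton M] : moduleRank R M = 0 :=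
  nonpos_iff_eq_zero.1 (submoduleRank_le_iff.2 fun _ h =>
    absurd (Subsingleton.elim _ _) h.ne)

theorem submoduleRank_range_add_le {f : N →ₗ[R] M} (hf : Function.Injective f)
    (P : Submodule R N) :
    submoduleRank (LinearMap.range f) + submoduleRank P ≤ submoduleRank (P.map f) := by
  induction P using WellFoundedGT.induction with
  | ind P ih =>
  rcases eq_or_ne (submoduleRank P) 0 with h0 | h0
  · rw [h0, add_zero]
    exact submoduleRank_strictAnti.antitone LinearMap.map_le_range
  refine (add_le_iff h0).2 fun c hc => ?_
  obtain ⟨Q, hQ, hcQ⟩ := lt_submoduleRank_iff.1 hc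
  calc _ ≤ submoduleRank (LinearMap.range f) + submoduleRank Q := by gcongr
    _ ≤ _ := ih Q hQ
    _ < _ := submoduleRank_strictAnti (Submodule.map_strictMono_of_injective hf hQ)

theorem moduleRank_add_le {f : N →ₗ[R] M} {g : M →ₗ[R] L} (hf : Function.Injective f)
    (hfg : Function.Exact f g) (hg : Function.Surjective g) :
    moduleRank R L + moduleRank R N ≤ moduleRank R M := by
  have h := submoduleRank_range_add_le hf ⊥
  rwa [← LinearMap.exact_iff.1 hfg, ← moduleRank_eq_of_surjective hg, Submodule.map_bot] at h

theorem moduleRank_le_of_injective {f : N →ₗ[R] M} (hf : Function.Injective f) :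
    moduleRank R N ≤ moduleRank R M := by
  have h := submoduleRank_range_add_le hf ⊥
  rw [Submodule.map_bot] at h
  exact le_add_self.trans h

/-- A strict inclusion P < Q stays strict in L or in N, and the natural sum is strictly monotone in
each argument. -/
theorem submoduleRank_le_naturalSum {f : N →ₗ[R] M} {g : M →ₗ[R] L}
    (hfg : Function.Exact f g) (P : Submodule R M) :
    submoduleRank P ≤ naturalSum (submoduleRank (P.map g)) (submoduleRank (P.comap f)) := by
  induction P using WellFoundedGT.induction with
  | ind P ih =>
  refine submoduleRank_le_iff.2 fun Q hQ => (ih Q hQ).trans_lt ?_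
  have hm : P.map g ≤ Q.map g := Submodule.map_mono hQ.le
  have hc : P.comap f ≤ Q.comap f := Submodule.comap_mono hQ.le
  rcases hm.lt_or_eq with hm | hm
  · exact (naturalSum_le_naturalSum le_rfl (submoduleRank_strictAnti.antitone hc)).trans_lt
      (naturalSum_lt_left _ (submoduleRank_strictAnti hm))
  rcases hc.lt_or_eq with hc | hc
  · rw [hm]
    exact naturalSum_lt_right _ (submoduleRank_strictAnti hc)
  refine absurd (le_antisymm hQ.le fun x hx => ?_) hQ.ne
  obtain ⟨y, hy, hxy⟩ : g x ∈ P.map g := hm ▸ Submodule.mem_map_of_mem hx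
  obtain ⟨z, hz⟩ := (hfg (x - y)).1 (by simp [hxy])
  have hzP : z ∈ P.comap f := by
    rw [hc, Submodule.mem_comap, hz]
    exact Q.sub_mem hx (hQ.le hy)
  rw [Submodule.mem_comap, hz] at hzP
  simpa using P.add_mem hzP hy

theorem moduleRank_le_naturalSum {f : N →ₗ[R] M} {g : M →ₗ[R] L} (hf : Function.Injective f)
    (hfg : Function.Exact f g) :
    moduleRank R M ≤ naturalSum (moduleRank R L) (moduleRank R N) := by
  have h := submoduleRank_le_naturalSum hfg ⊥
  rwa [Submodule.map_bot, Submodule.comap_bot, LinearMap.ker_eq_bot.2 hf] at h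

theorem chainTypes_le_moduleRank {α : Ordinal.{v}} (h : α ∈ chainTypes R M) :
    α ≤ moduleRank R M := by
  obtain ⟨C, hC, hC0⟩ := h
  have key : ∀ i < α, i ≤ submoduleRank (C i) := by
    intro i
    induction i using WellFoundedLT.induction with
    | ind i ih =>
    intro hi
    refine le_of_forall_lt fun j hj => (ih j hj (hj.trans hi)).trans_lt ?_
    exact submoduleRank_strictAnti (hC (hj.trans hi) hi hj)
  exact le_of_forall_lt fun i hi => (key i hi).trans_lt
    (submoduleRank_strictAnti (bot_lt_iff_ne_bot.2 (hC0 i hi)))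

theorem len_eq_moduleRank_of_mem_chainTypes (h : moduleRank R M ∈ chainTypes R M) :
    len R M = moduleRank R M :=
  le_antisymm (csSup_le ⟨_, h⟩ fun _ => chainTypes_le_moduleRank)
    (le_csSup (bddAbove_chainTypes R M) h)

/-- Take P maximal among submodules of rank at least ω^a: everything above it has smaller rank, so
M/P has rank exactly ω^a. The two bounds for extensions then pin down the rank of P. -/
theorem exists_submodule_moduleRank_eq {a x : Ordinal.{v}} (hx : x < ω ^ succ a)
    (h : moduleRank R M = ω ^ a + x) :
    ∃ P : Submodule R M, moduleRank R (M ⧸ P) = ω ^ a ∧ moduleRank R P = x := by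
  obtain ⟨P, hP, hmax⟩ := wellFounded_gt.has_min {P : Submodule R M | ω ^ a ≤ submoduleRank P}
    ⟨⊥, by rw [Set.mem_ofPred_eq, ← moduleRank, h]; exact le_self_add⟩
  have hQ : moduleRank R (M ⧸ P) = ω ^ a := by
    rw [moduleRank_quotient]
    refine le_antisymm (submoduleRank_le_iff.2 fun P' hP' => ?_) hP
    exact not_le.1 fun h' => hmax P' h' hP'
  have hex : Function.Exact P.subtype P.mkQ := LinearMap.exact_subtype_mkQ P
  refine ⟨P, hQ, le_antisymm ?_ ?_⟩
  · have := moduleRank_add_le P.injective_subtype hex P.mkQ_surjective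
    rw [hQ, h] at this
    exact le_of_add_le_add_left this
  · by_contra! hlt
    have := moduleRank_le_naturalSum P.injective_subtype hex
    rw [hQ, h] at this
    have h2 := (naturalSum_lt_right (ω ^ a) hlt).trans_le (omega0_opow_naturalSum_le hx)
    exact absurd (this.trans_lt h2) (lt_irrefl _)

end Rank

/-! ### Dimensions of primes and chains of type ω^d. -/

section Dimension

variable {R : Type u} [CommRing R]

theorem ringKrullDim_quotient_eq_coheight (p : Ideal R) (hp : p.IsPrime) :
    ringKrullDim (R ⧸ p) = coheight (⟨p, hp⟩ : PrimeSpectrum R) := by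
  rw [ringKrullDim_quotient, coheight_eq_krullDim_Ici]
  congr

theorem ringKrullDim_quotient_lt {p q : Ideal R} (hp : p.IsPrime) (hq : q.IsPrime) (h : p < q)
    {d : ℕ} (hd : ringKrullDim (R ⧸ p) = d) : ∃ e : ℕ, e < d ∧ ringKrullDim (R ⧸ q) = e := by
  rw [ringKrullDim_quotient_eq_coheight p hp] at hd
  have hd' : coheight (⟨p, hp⟩ : PrimeSpectrum R) = d := by exact_mod_cast hd
  have hlt := coheight_add_one_le (a := (⟨q, hq⟩ : PrimeSpectrum R)) (b := ⟨p, hp⟩) h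
  rw [hd'] at hlt
  generalize hc : coheight (⟨q, hq⟩ : PrimeSpectrum R) = c at hlt
  induction c with
  | top => simp at hlt
  | coe e =>
    refine ⟨e, by exact_mod_cast hlt, ?_⟩
    rw [ringKrullDim_quotient_eq_coheight q hq, hc]
    rfl

theorem exists_ringKrullDim_quotient_eq {p : Ideal R} (hp : p.IsPrime) {d : ℕ}
    (hd : ringKrullDim (R ⧸ p) = (d + 1 : ℕ)) :
    ∃ q : Ideal R, q.IsPrime ∧ p < q ∧ ringKrullDim (R ⧸ q) = d := by
  rw [ringKrullDim_quotient_eq_coheight p hp] at hd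
  have hd' : coheight (⟨p, hp⟩ : PrimeSpectrum R) = d + 1 := by exact_mod_cast hd
  obtain ⟨⟨q, hq⟩, hpq, hqd⟩ := (coheight_eq_coe_add_one_iff.1 hd').2.1
  refine ⟨q, hq, hpq, ?_⟩
  rw [ringKrullDim_quotient_eq_coheight q hq, hqd]
  rfl

theorem exists_ringKrullDim_quotient_eq_natCast (hdim : ringKrullDim R < ⊤) {p : Ideal R}
    (hp : p.IsPrime) : ∃ d : ℕ, ringKrullDim (R ⧸ p) = d := by
  have h := (ringKrullDim_quotient_le p).trans_lt hdim
  rw [ringKrullDim_quotient_eq_coheight p hp] at h ⊢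
  generalize coheight (⟨p, hp⟩ : PrimeSpectrum R) = c at h
  induction c with
  | top => exact absurd h (lt_irrefl _)
  | coe e => exact ⟨e, rfl⟩

/-- For p of dimension d + 1, choose a prime q above p of dimension d, with its chain C, and x in q
outside p. The ideals p + x^n C_i, ordered lexicographically by (n, i), form ω consecutive copies of
C: x is a nonzerodivisor modulo p, and being in q it puts the copy n + 1 below p + x^n q. -/
theorem exists_strictAntiOn_ideal (d : ℕ) : ∀ (p : Ideal R) (_ : p.IsPrime),
    ringKrullDim (R ⧸ p) = d → ∃ C : Ordinal.{v} → Ideal R,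
      StrictAntiOn C (Set.Iio (ω ^ (d : Ordinal.{v}))) ∧ ∀ i < ω ^ (d : Ordinal.{v}), p < C i := by
  induction d with
  | zero =>
    intro p hp _
    refine ⟨fun _ => ⊤, fun i hi j hj hij => ?_, fun _ _ => hp.ne_top.lt_top⟩
    simp only [Nat.cast_zero, opow_zero, Set.mem_Iio, Order.lt_one_iff] at hi hj
    exact absurd (hi.trans hj.symm) hij.ne
  | succ d ih =>
    intro p hp hd
    obtain ⟨q, hq, hpq, hqd⟩ := exists_ringKrullDim_quotient_eq hp hd
    obtain ⟨C, hC, hCq⟩ := ih q hq hqd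
    obtain ⟨x, hxq, hxp⟩ := Set.exists_of_ssubset (show (p : Set R) ⊂ q from hpq)
    set w : Ordinal.{v} := ω ^ (d : Ordinal.{v}) with hw
    have hw0 : w ≠ 0 := (opow_pos _ omega0_pos).ne'
    have hdiv : ∀ i < ω ^ ((d + 1 : ℕ) : Ordinal.{v}), ∃ n : ℕ, i / w = n := by
      intro i hi
      rw [Nat.cast_succ, opow_add, opow_one] at hi
      exact lt_omega0.1 ((lt_mul_iff_div_lt hw0).1 hi)
    choose! n hn using hdiv
    -- multiplication by powers of `x` is strictly monotone modulo `p`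
    have hmono : ∀ (k : ℕ) (I J : Ideal R), p ≤ I → I < J →
        p ⊔ Ideal.span {x ^ k} * I < p ⊔ Ideal.span {x ^ k} * J := by
      intro k I J hpI hIJ
      refine lt_of_le_of_ne (sup_le_sup_left (Ideal.mul_mono_right hIJ.le) _) fun h => ?_
      obtain ⟨b, hbJ, hbI⟩ := Set.exists_of_ssubset (show (I : Set R) ⊂ J from hIJ)
      have hb : x ^ k * b ∈ p ⊔ Ideal.span {x ^ k} * I := by
        rw [h]
        exact Ideal.mem_sup_right (Ideal.mul_mem_mul (Ideal.mem_span_singleton_self _) hbJ)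
      obtain ⟨y, hy, z, hz, hyz⟩ := Submodule.mem_sup.1 hb
      obtain ⟨a, ha, rfl⟩ := Ideal.mem_span_singleton_mul.1 hz
      have : x ^ k * (b - a) ∈ p := by
        have : x ^ k * (b - a) = y := by linear_combination -hyz
        rwa [this]
      rcases hp.mem_or_mem this with h' | h'
      · exact hxp (hp.mem_of_pow_mem _ h')
      · exact hbI (by simpa using I.add_mem (hpI h') ha)
    have hle : ∀ (k l : ℕ) (I : Ideal R), k < l →
        Ideal.span {x ^ l} * I ≤ Ideal.span {x ^ k} * q := by
      intro k l I hkl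
      rw [Ideal.span_singleton_mul_le_iff]
      intro z _
      obtain ⟨m, rfl⟩ := Nat.exists_eq_add_of_lt hkl
      have : x ^ (k + m + 1) * z = x ^ k * (x * (x ^ m * z)) := by ring
      rw [this]
      exact Ideal.mul_mem_mul (Ideal.mem_span_singleton_self _) (q.mul_mem_right _ hxq)
    -- Division with remainder by w = ω^d: the quotient selects the power of x, the remainder the
    -- position in C.
    refine ⟨fun i => p ⊔ Ideal.span {x ^ n i} * C (i % w), fun i hi j hj hij => ?_, fun i hi => ?_⟩
    · have hni := hn i hi
      have hnj := hn j hj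
      have hmi := mod_lt i hw0
      have hmj := mod_lt j hw0
      have hnn : n i ≤ n j := by
        have := div_le_left hij.le w
        rw [hni, hnj] at this
        exact_mod_cast this
      rcases hnn.lt_or_eq with h | h
      · calc p ⊔ Ideal.span {x ^ n j} * C (j % w)
            ≤ p ⊔ Ideal.span {x ^ n i} * q := sup_le_sup_left (hle _ _ _ h) _
          _ < _ := hmono _ _ _ hpq.le (hCq _ hmi)
      · dsimp only
        rw [← h]
        refine hmono _ _ _ (hpq.trans (hCq _ hmj)).le (hC hmi hmj ?_)
        have h₁ := div_add_mod i w
        have h₂ := div_add_mod j w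
        rw [hni] at h₁
        rw [hnj, ← h] at h₂
        rw [← h₁, ← h₂] at hij
        exact lt_of_add_lt_add_left hij
    · calc p ≤ p ⊔ Ideal.span {x ^ n i} * p := le_sup_left
        _ < _ := hmono _ _ _ le_rfl (hpq.trans (hCq _ (mod_lt i hw0)))

/-- A nonzero element y of a submodule of R/p has annihilator p, so r ↦ r • y carries a chain of
ideals above p strictly into M. -/
theorem omega0_opow_mem_chainTypes {M : Type v} [AddCommGroup M] [Module R M] [Nontrivial M]
    {p : Ideal R} (hp : p.IsPrime) {d : ℕ} (hd : ringKrullDim (R ⧸ p) = d)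
    {f : M →ₗ[R] R ⧸ p} (hf : Function.Injective f) :
    ω ^ (d : Ordinal.{v}) ∈ chainTypes R M := by
  obtain ⟨C, hC, hCp⟩ := exists_strictAntiOn_ideal.{u, v} d p hp hd
  obtain ⟨y, hy⟩ := exists_ne (0 : M)
  set φ := LinearMap.toSpanSingleton R M y
  have hker : LinearMap.ker φ = p := by
    obtain ⟨z, hz⟩ := Ideal.Quotient.mk_surjective (f y)
    have hzp : z ∉ p := fun h => hy <| hf <| by
      rw [← hz, map_zero, Ideal.Quotient.eq_zero_iff_mem.2 h]
    ext r
    have hr : f (r • y) = Ideal.Quotient.mk p (r * z) := by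
      rw [map_smul, ← hz, map_mul]
      rfl
    rw [LinearMap.mem_ker, LinearMap.toSpanSingleton_apply, ← map_eq_zero_iff f hf, hr,
      Ideal.Quotient.eq_zero_iff_mem, hp.mul_mem_iff_mem_or_mem]
    simp [hzp]
  have hmono : ∀ I J : Ideal R, p ≤ I → I < J → Submodule.map φ I < Submodule.map φ J := by
    intro I J hI hIJ
    refine lt_of_le_of_ne (Submodule.map_mono hIJ.le) fun h => hIJ.ne ?_
    have h' := congrArg (Submodule.comap φ) h
    rwa [Submodule.comap_map_eq, Submodule.comap_map_eq, hker, sup_eq_left.2 hI,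
      sup_eq_left.2 (hI.trans hIJ.le)] at h'
  refine ⟨fun i => Submodule.map φ (C i), fun i hi j hj hij => ?_, fun i hi => ?_⟩
  · exact hmono _ _ (hCp j hj).le (hC hi hj hij)
  · exact (bot_le.trans_lt (hmono p _ le_rfl (hCp i hi))).ne'

end Dimension

/-! ### Modules whose rank is a power of ω. -/

section Univalent

variable {R : Type u} [CommRing R] [IsNoetherianRing R]

/-- Proper quotients have rank below ω^b, and ω^b is indecomposable for natural sums, so every
nonzero submodule has rank at least ω^b. Thus no nonzero submodule embeds in a proper quotient. This
makes M torsion-free of rank one over R/q, with q the annihilator of any nonzero element. -/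
theorem exists_injective_to_quotient_prime {M : Type v} [AddCommGroup M] [Module R M]
    [Module.Finite R M] {b : Ordinal.{v}} (h : moduleRank R M = ω ^ b) :
    Nontrivial M ∧ ∃ q : Ideal R, q.IsPrime ∧ ∃ f : M →ₗ[R] R ⧸ q, Function.Injective f := by
  have hpos : 0 < ω ^ b := opow_pos _ omega0_pos
  have hM : Nontrivial M := by
    by_contra hM
    rw [not_nontrivial_iff_subsingleton] at hM
    exact hpos.ne' (h.symm.trans moduleRank_eq_zero)
  refine ⟨hM, ?_⟩
  have hquot : ∀ P : Submodule R M, P ≠ ⊥ → moduleRank R (M ⧸ P) < ω ^ b := fun P hP => by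
    rw [moduleRank_quotient, ← h]
    exact submoduleRank_strictAnti (bot_lt_iff_ne_bot.2 hP)
  have hsub : ∀ P : Submodule R M, P ≠ ⊥ → ω ^ b ≤ moduleRank R P := fun P hP => by
    by_contra! hlt
    have h1 := moduleRank_le_naturalSum P.injective_subtype (LinearMap.exact_subtype_mkQ P)
    exact (h1.trans_lt (naturalSum_lt_omega0_opow b _ (hquot P hP) _ hlt)).ne h
  -- every scalar acts on `M` as zero or injectively
  have hsmul : ∀ (r : R) (x : M), x ≠ 0 → r • x = 0 → ∀ y : M, r • y = 0 := by
    intro r x hx hrx y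
    by_contra hry
    set φ : M →ₗ[R] M := LinearMap.lsmul R M r with hφ
    have hk : LinearMap.ker φ ≠ ⊥ := fun hk => hx <| by
      have : x ∈ LinearMap.ker φ := hrx
      rwa [hk, Submodule.mem_bot] at this
    have hr : LinearMap.range φ ≠ ⊥ := fun hr => hry <| by
      have : φ y ∈ LinearMap.range φ := ⟨y, rfl⟩
      rwa [hr, Submodule.mem_bot] at this
    have := hsub _ hr
    rw [← moduleRank_congr φ.quotKerEquivRange] at this
    exact absurd (hquot _ hk) (not_lt.2 this)
  obtain ⟨x, hx⟩ := exists_ne (0 : M)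
  set q : Ideal R := LinearMap.ker (LinearMap.toSpanSingleton R M x) with hqdef
  have hmem : ∀ r, r ∈ q ↔ r • x = 0 := fun r => by simp [hqdef]
  have hq : q.IsPrime := by
    refine ⟨fun htop => hx ?_, fun {r s} hrs => ?_⟩
    · have := (hmem 1).1 (htop ▸ Submodule.mem_top)
      rwa [one_smul] at this
    · rw [hmem, mul_smul] at hrs
      rw [hmem, hmem]
      by_cases hs : s • x = 0
      · exact .inr hs
      · exact .inl (hsmul r _ hs hrs x)
  refine ⟨q, hq, ?_⟩
  -- Otherwise Ry would meet Rx trivially and embed in the proper quotient M/Rx.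
  have hdenom : ∀ y : M, ∃ a : R, a ∉ q ∧ a • y ∈ Submodule.span R {x} := by
    intro y
    by_contra! hy
    have hy0 : y ≠ 0 := fun h0 => hy 1 (q.ne_top_iff_one.1 hq.ne_top) (by simp [h0])
    set P := Submodule.span R {x} with hP
    set Q := Submodule.span R {y} with hQ
    have hP0 : P ≠ ⊥ := by simpa [hP] using hx
    have hQ0 : Q ≠ ⊥ := by simpa [hQ] using hy0
    have hinj : Function.Injective (P.mkQ ∘ₗ Q.subtype) := by
      rw [← LinearMap.ker_eq_bot, LinearMap.ker_eq_bot']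
      rintro ⟨z, hz⟩ hzP
      obtain ⟨a, rfl⟩ := Submodule.mem_span_singleton.1 hz
      have hzP' : a • y ∈ P := (Submodule.Quotient.mk_eq_zero P).1 hzP
      have haq : a ∈ q := by
        by_contra haq
        exact hy a haq hzP'
      exact Subtype.ext (hsmul a x hx ((hmem a).1 haq) y)
    exact absurd (hquot P hP0) (not_lt.2 ((hsub Q hQ0).trans (moduleRank_le_of_injective hinj)))
  obtain ⟨a, haq, ha⟩ : ∃ a : R, a ∉ q ∧ ∀ y : M, a • y ∈ Submodule.span R {x} := by
    obtain ⟨s, hs⟩ := Module.Finite.fg_top (R := R) (M := M)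
    choose c hcq hc using hdenom
    refine ⟨∏ y ∈ s, c y, fun hprod => ?_, fun y => ?_⟩
    · obtain ⟨y, -, hy⟩ := (hq.prod_mem_iff).1 hprod
      exact hcq y hy
    · have hle : (⊤ : Submodule R M) ≤ (Submodule.span R {x}).comap
          (LinearMap.lsmul R M (∏ y ∈ s, c y)) := by
        rw [← hs, Submodule.span_le]
        intro y hy
        obtain ⟨t, ht⟩ := Finset.dvd_prod_of_mem c hy
        change (∏ y ∈ s, c y) • y ∈ Submodule.span R {x}
        rw [ht, mul_comm, mul_smul]
        exact Submodule.smul_mem _ _ (hc y)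
      exact hle (Submodule.mem_top (x := y))
  let e : (R ⧸ q) ≃ₗ[R] Submodule.span R {x} :=
    (LinearMap.toSpanSingleton R M x).quotKerEquivRange ≪≫ₗ
      LinearEquiv.ofEq _ _ (LinearMap.range_toSpanSingleton x)
  -- A common denominator a outside q acts injectively and maps M into Rx ≅ R/q.
  refine ⟨e.symm.toLinearMap ∘ₗ (LinearMap.lsmul R M a).codRestrict _ ha, ?_⟩
  rw [LinearMap.coe_comp]
  refine e.symm.injective.comp ?_
  rw [← LinearMap.ker_eq_bot, LinearMap.ker_eq_bot']
  intro y hy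
  by_contra hy0
  exact haq ((hmem a).2 (hsmul a y hy0 (congrArg Subtype.val hy) x))

/-- The chain of type ω^d gives the lower bound. For the upper one, a proper quotient of M is killed
by an ideal strictly above p, so it is built by extensions from R/q with dim R/q < d; the natural
sum of their ranks stays below ω^d. -/
theorem moduleRank_eq_omega0_opow (d : ℕ) : ∀ {p : Ideal R} (_ : p.IsPrime)
    (_ : ringKrullDim (R ⧸ p) = d) {M : Type v} [AddCommGroup M] [Module R M] [Module.Finite R M]
    [Nontrivial M] {f : M →ₗ[R] R ⧸ p} (_ : Function.Injective f),
    moduleRank R M = ω ^ (d : Ordinal.{v}) := by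
  induction d using Nat.strong_induction_on with
  | _ d ih =>
  intro p hp hd M _ _ _ _ f hf
  refine le_antisymm ?_ (chainTypes_le_moduleRank (omega0_opow_mem_chainTypes hp hd hf))
  have key : ∀ (I : Ideal R), p < I → ∀ (L : Type v) [AddCommGroup L] [Module R L]
      [Module.Finite R L], I ≤ Module.annihilator R L →
      moduleRank R L < ω ^ (d : Ordinal.{v}) := by
    intro I hI L _ _ hL
    induction hL using IsNoetherianRing.induction_on_isQuotientEquivQuotientPrime R with
    | subsingleton N =>
      intro _
      rw [moduleRank_eq_zero]
      exact opow_pos _ omega0_pos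
    | quotient N q e =>
      intro hN
      have hpq : p < q.1 := by
        refine hI.trans_le (hN.trans ?_)
        rw [e.annihilator_eq, Ideal.annihilator_quotient]
      obtain ⟨c, hcd, hc⟩ := ringKrullDim_quotient_lt hp q.2 hpq hd
      have : Nontrivial N := e.toEquiv.nontrivial
      rw [ih c hcd q.2 hc (f := e.toLinearMap) e.injective]
      exact (opow_lt_opow_iff_right one_lt_omega0).2 (by exact_mod_cast hcd)
    | exact N₁ N₂ N₃ g₁ g₂ hg₁ hg₂ hg h₁ h₃ =>
      intro hN
      refine (moduleRank_le_naturalSum hg₁ hg).trans_lt (naturalSum_lt_omega0_opow _ _ ?_ _ ?_)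
      · exact h₃ (hN.trans (g₂.annihilator_le_of_surjective hg₂))
      · exact h₁ (hN.trans (g₁.annihilator_le_of_injective hg₁))
  refine submoduleRank_le_iff.2 fun P hP => ?_
  rw [← moduleRank_quotient]
  obtain ⟨y, hyP, hy⟩ := Submodule.exists_mem_ne_zero_of_ne_bot hP.ne'
  obtain ⟨z, hz⟩ := Ideal.Quotient.mk_surjective (f y)
  have hzp : z ∉ p := fun h => hy <| hf <| by
    rw [← hz, map_zero, Ideal.Quotient.eq_zero_iff_mem.2 h]
  have hf' : ∀ (r : R) (m : M), ∃ n : R, f m = Ideal.Quotient.mk p n ∧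
      f (r • m) = Ideal.Quotient.mk p (r * n) := by
    intro r m
    obtain ⟨n, hn⟩ := Ideal.Quotient.mk_surjective (f m)
    refine ⟨n, hn.symm, ?_⟩
    rw [map_smul, ← hn, map_mul]
    rfl
  refine key (p ⊔ Ideal.span {z}) (left_lt_sup.2 fun h => hzp (h (Ideal.mem_span_singleton_self z)))
    _ (sup_le (fun r hr => ?_) ((Ideal.span_singleton_le_iff_mem _).2 ?_))
  · rw [Module.mem_annihilator]
    intro m
    obtain ⟨m, rfl⟩ := P.mkQ_surjective m
    obtain ⟨n, -, hn⟩ := hf' r m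
    have : r • m = 0 := hf <| by
      rw [hn, map_zero, Ideal.Quotient.eq_zero_iff_mem.2 (p.mul_mem_right _ hr)]
    rw [← map_smul, this, map_zero]
  · rw [Module.mem_annihilator]
    intro m
    obtain ⟨m, rfl⟩ := P.mkQ_surjective m
    obtain ⟨n, hn, hn'⟩ := hf' z m
    -- Viewed in R/p, y is z and m is n, so z • m and n • y are both zn; hence z sends M into P.
    have : z • m = n • y := hf <| by
      rw [hn', map_smul, ← hz, mul_comm, map_mul]
      rfl
    rw [← map_smul, this, map_smul, P.mkQ_apply, (Submodule.Quotient.mk_eq_zero P).2 hyP,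
      smul_zero]

/-- The rank itself is the type of a chain: split off the leading power of ω as the rank of a
quotient, which embeds in some R/p and has a chain of that type, and continue inside the submodule
of smaller rank. -/
theorem len_eq_moduleRank (hdim : ringKrullDim R < ⊤) (M : Type v) [AddCommGroup M] [Module R M]
    [Module.Finite R M] : len R M = moduleRank R M := by
  refine len_eq_moduleRank_of_mem_chainTypes ?_
  generalize ho : moduleRank R M = o
  induction o using WellFoundedLT.induction generalizing M with
  | ind o ih =>
  rcases eq_or_ne o 0 with rfl | h0
  · exact ⟨fun _ => ⊥, fun i hi => absurd (Set.mem_Iio.1 hi) not_lt_zero,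
      fun i hi => absurd hi not_lt_zero⟩
  have hle : ω ^ log ω o ≤ o := opow_log_le_self ω h0
  have hlt := sub_omega0_opow_log_lt h0
  have hsum : ω ^ log ω o + (o - ω ^ log ω o) = o := Ordinal.add_sub_cancel_of_le hle
  obtain ⟨P, hQ, hP⟩ := exists_submodule_moduleRank_eq
    (hlt.trans (lt_opow_succ_log_self one_lt_omega0 o)) (ho.trans hsum.symm)
  obtain ⟨_, p, hp, f, hf⟩ := exists_injective_to_quotient_prime hQ
  obtain ⟨d, hd⟩ := exists_ringKrullDim_quotient_eq_natCast hdim hp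
  have hQ' := omega0_opow_mem_chainTypes hp hd hf
  rw [← moduleRank_eq_omega0_opow d hp hd hf, hQ] at hQ'
  rw [← hsum]
  exact add_mem_chainTypes P.injective_subtype (LinearMap.exact_subtype_mkQ P) P.mkQ_surjective
    hQ' (ih _ hlt P hP)

end Univalent

/-! ### Extensions of ideals of residue rings, and their lengths. -/

section Extension

variable {R : Type u} [CommRing R]

theorem exists_linearEquiv_extendedIdeal {M : Type v} [AddCommGroup M] [Module R M] [Nontrivial M]
    {q : Ideal R} {f : M →ₗ[R] R ⧸ q} (hf : Function.Injective f) :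
    ∃ J : Ideal R, q < J ∧ Nonempty (M ≃ₗ[R] extendedIdeal J q) := by
  let J : Ideal R := (LinearMap.range f).comap q.mkQ
  have hmem : ∀ x, x ∈ extendedIdeal J q ↔ x ∈ LinearMap.range f := by
    intro x
    rw [Ideal.mem_map_iff_of_surjective _ Ideal.Quotient.mk_surjective]
    constructor
    · rintro ⟨r, hr, rfl⟩
      exact hr
    · intro hx
      obtain ⟨r, rfl⟩ := Ideal.Quotient.mk_surjective x
      exact ⟨r, hx, rfl⟩
  refine ⟨J, lt_of_le_of_ne (fun r hr => ?_) fun h => ?_, ⟨?_⟩⟩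
  · have : q.mkQ r = 0 := (Submodule.Quotient.mk_eq_zero q).2 hr
    change q.mkQ r ∈ LinearMap.range f
    rw [this]
    exact zero_mem _
  · obtain ⟨y, hy⟩ := exists_ne (0 : M)
    obtain ⟨z, hz⟩ := Ideal.Quotient.mk_surjective (f y)
    have hzJ : z ∈ J := ⟨y, hz.symm⟩
    rw [← h, ← Ideal.Quotient.eq_zero_iff_mem, hz] at hzJ
    exact hy (hf (hzJ.trans (map_zero f).symm))
  · refine LinearEquiv.ofInjective f hf ≪≫ₗ LinearEquiv.ofEq _
      ((extendedIdeal J q).restrictScalars R) ?_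
    ext x
    exact (hmem x).symm

theorem exists_injective_extendedIdeal {p I : Ideal R} (h : p < I) :
    Nontrivial (extendedIdeal I p) ∧
      ∃ f : extendedIdeal I p →ₗ[R] R ⧸ p, Function.Injective f := by
  refine ⟨?_, ((extendedIdeal I p).subtype.restrictScalars R), Subtype.val_injective⟩
  obtain ⟨x, hxI, hxp⟩ := Set.exists_of_ssubset (show (p : Set R) ⊂ I from h)
  refine ⟨⟨⟨_, Ideal.mem_map_of_mem _ hxI⟩, 0, fun h0 => hxp ?_⟩⟩
  exact Ideal.Quotient.eq_zero_iff_mem.1 (congrArg Subtype.val h0)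

variable [IsNoetherianRing R]

/-- The condition on dimensions makes ω^b < ω^(a+1), which is what lets the natural-sum bound
collapse to the ordinary sum. -/
theorem len_eq_of_isExtensionOfIdeals (hdim : ringKrullDim R < ⊤) {M : Type v} [AddCommGroup M]
    [Module R M] [Module.Finite R M] {p q I J : Ideal R} (hp : p.IsPrime) (hq : q.IsPrime)
    (hI : p < I) (hJ : q < J) (hqp : ringKrullDim (R ⧸ q) ≤ ringKrullDim (R ⧸ p))
    (h : IsExtensionOfIdeals M p q I J) :
    ∃ a b : ℕ, b ≤ a ∧ ringKrullDim (R ⧸ p) = a ∧ ringKrullDim (R ⧸ q) = b ∧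
      len R M = ω ^ (a : Ordinal.{v}) + ω ^ (b : Ordinal.{v}) := by
  obtain ⟨f, g, hf, hfg, hg⟩ := h
  obtain ⟨a, ha⟩ := exists_ringKrullDim_quotient_eq_natCast hdim hp
  obtain ⟨b, hb⟩ := exists_ringKrullDim_quotient_eq_natCast hdim hq
  have hba : b ≤ a := by
    rw [ha, hb] at hqp
    exact_mod_cast hqp
  refine ⟨a, b, hba, ha, hb, ?_⟩
  obtain ⟨_, i, hi⟩ := exists_injective_extendedIdeal hI
  obtain ⟨_, j, hj⟩ := exists_injective_extendedIdeal hJ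
  let P := LinearMap.range f
  let eQ : (M ⧸ P) ≃ₗ[R] extendedIdeal I p :=
    Submodule.quotEquivOfEq _ _ (LinearMap.exact_iff.1 hfg).symm ≪≫ₗ
      g.quotKerEquivOfSurjective hg
  let eP : P ≃ₗ[R] extendedIdeal J q := (LinearEquiv.ofInjective f hf).symm
  have : Nontrivial (M ⧸ P) := eQ.toEquiv.nontrivial
  have : Nontrivial P := eP.toEquiv.nontrivial
  have hQ : moduleRank R (M ⧸ P) = ω ^ (a : Ordinal.{v}) :=
    moduleRank_eq_omega0_opow a hp ha (f := i ∘ₗ eQ.toLinearMap) (hi.comp eQ.injective)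
  have hP : moduleRank R P = ω ^ (b : Ordinal.{v}) :=
    moduleRank_eq_omega0_opow b hq hb (f := j ∘ₗ eP.toLinearMap) (hj.comp eP.injective)
  have hex : Function.Exact P.subtype P.mkQ := LinearMap.exact_subtype_mkQ P
  rw [len_eq_moduleRank hdim]
  refine le_antisymm ?_ ?_
  · refine (moduleRank_le_naturalSum P.injective_subtype hex).trans ?_
    rw [hQ, hP]
    refine omega0_opow_naturalSum_le ((opow_lt_opow_iff_right one_lt_omega0).2 ?_)
    exact Order.lt_succ_of_le (by exact_mod_cast hba)
  · rw [← hQ, ← hP]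
    exact moduleRank_add_le P.injective_subtype hex P.mkQ_surjective

theorem exists_isExtensionOfIdeals (hdim : ringKrullDim R < ⊤) {M : Type v} [AddCommGroup M]
    [Module R M] [Module.Finite R M] {a b : Ordinal.{v}} (hba : b ≤ a)
    (h : len R M = ω ^ a + ω ^ b) :
    ∃ p q I J : Ideal R, p.IsPrime ∧ q.IsPrime ∧ p < I ∧ q < J ∧
      ringKrullDim (R ⧸ q) ≤ ringKrullDim (R ⧸ p) ∧ IsExtensionOfIdeals M p q I J := by
  rw [len_eq_moduleRank hdim] at h
  obtain ⟨P, hQ, hP⟩ := exists_submodule_moduleRank_eq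
    ((opow_lt_opow_iff_right one_lt_omega0).2 (Order.lt_succ_of_le hba)) h
  obtain ⟨_, p, hp, i, hi⟩ := exists_injective_to_quotient_prime hQ
  obtain ⟨_, q, hq, j, hj⟩ := exists_injective_to_quotient_prime hP
  obtain ⟨c, hc⟩ := exists_ringKrullDim_quotient_eq_natCast hdim hp
  obtain ⟨d, hd⟩ := exists_ringKrullDim_quotient_eq_natCast hdim hq
  obtain ⟨I, hI, ⟨eI⟩⟩ := exists_linearEquiv_extendedIdeal hi
  obtain ⟨J, hJ, ⟨eJ⟩⟩ := exists_linearEquiv_extendedIdeal hj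
  have hac := hQ.symm.trans (moduleRank_eq_omega0_opow c hp hc hi)
  have hbd := hP.symm.trans (moduleRank_eq_omega0_opow d hq hd hj)
  have hac' : a = c := (opow_right_inj one_lt_omega0).1 hac
  have hbd' : b = d := (opow_right_inj one_lt_omega0).1 hbd
  refine ⟨p, q, I, J, hp, hq, hI, hJ, ?_, P.subtype ∘ₗ eJ.symm.toLinearMap,
    eI.toLinearMap ∘ₗ P.mkQ, P.injective_subtype.comp eJ.symm.injective, ?_,
    eI.surjective.comp P.mkQ_surjective⟩
  · rw [hac', hbd'] at hba
    rw [hc, hd]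
    exact_mod_cast hba
  · intro x
    have h1 : eI (P.mkQ x) = 0 ↔ x ∈ P := by
      rw [LinearEquiv.map_eq_zero_iff, P.mkQ_apply, Submodule.Quotient.mk_eq_zero]
    refine h1.trans ⟨fun hx => ⟨eJ ⟨x, hx⟩, by simp⟩, ?_⟩
    rintro ⟨y, rfl⟩
    exact (eJ.symm y).2

end Extension

end TransfiniteLength

theorem propositionP (R : Type u) [CommRing R] [IsNoetherianRing R] (hdim : ringKrullDim R < ⊤)
    (M : Type v) [AddCommGroup M] [Module R M] [Module.Finite R M] :
    (TransfiniteLength.IsBivalent R M ↔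
      ∃ p q I J : Ideal R, p.IsPrime ∧ q.IsPrime ∧ p < I ∧ q < J ∧
        ringKrullDim (R ⧸ q) ≤ ringKrullDim (R ⧸ p) ∧
        TransfiniteLength.IsExtensionOfIdeals M p q I J) ∧
    (TransfiniteLength.HasBinaryLength R M →
      ∀ p q I J : Ideal R, p.IsPrime → q.IsPrime → p < I → q < J →
        ringKrullDim (R ⧸ q) ≤ ringKrullDim (R ⧸ p) →
        TransfiniteLength.IsExtensionOfIdeals M p q I J →
        ringKrullDim (R ⧸ q) < ringKrullDim (R ⧸ p)) := by
  refine ⟨⟨fun h => ?_, ?_⟩, fun hbin p q I J hp hq hI hJ hqp h => ?_⟩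
  · obtain ⟨a, b, hba, hab⟩ := TransfiniteLength.exists_eq_omega0_opow_add_of_valence_eq_two h
    exact TransfiniteLength.exists_isExtensionOfIdeals hdim hba hab
  · rintro ⟨p, q, I, J, hp, hq, hI, hJ, hqp, h⟩
    obtain ⟨a, b, hba, -, -, hlen⟩ :=
      TransfiniteLength.len_eq_of_isExtensionOfIdeals hdim hp hq hI hJ hqp h
    rw [TransfiniteLength.IsBivalent, hlen]
    exact TransfiniteLength.valence_omega0_opow_add (by exact_mod_cast hba)
  -- Equal dimensions would give length ω^b + ω^b = ω^b·2, with a coefficient 2.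
  · refine lt_of_le_of_ne hqp fun heq => ?_
    obtain ⟨a, b, -, ha, hb, hlen⟩ :=
      TransfiniteLength.len_eq_of_isExtensionOfIdeals hdim hp hq hI hJ hqp h
    have hab : a = b := by
      rw [ha, hb] at heq
      exact_mod_cast heq.symm
    rw [TransfiniteLength.HasBinaryLength, hlen, hab] at hbin
    exact TransfiniteLength.not_isBinaryOrdinal_omega0_opow_add_self _ hbin
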